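/- Let $G$ be a (discrete) group with identity $e$ and let $\sigma\colon G\times G\to\mathbb{T}$ be a normalized two-cocycle, i.e. $\sigma(g,h)\sigma(gh,k)=\sigma(h,k)\sigma(g,hk)$ and $\sigma(g,e)=\sigma(e,g)=1$ for all $g,h,k\in G$. Let $\lambda_\sigma$ be the left regular $\sigma$-projective unitary representation of $G$ on $\ell^2(G)$, $(\lambda_\sigma(g)\xi)(h)=\sigma(g,g^{-1}h)\,\xi(g^{-1}h)$, let $C^*_r(G,\sigma)\subset B(\ell^2(G))$ be the C$^*$-algebra generated by $\lambda_\sigma(G)$, and let $\tau(a)=\langle a\delta_e,\delta_e\rangle$ be its canonical tracial state. Let $FC(G)$ be the subgroup of all elements of $G$ whose conjugacy class is finite, let $A_{FC}$ be the C$^*$-subalgebra of $C^*_r(G,\sigma)$ generated by $\{\lambda_\sigma(g) : g\in FC(G)\}$, and let $\tau_{FC}$ be the restriction of $\tau$ to $A_{FC}$. Let $\gamma$ be the action of $G$ on $A_{FC}$ by $*$-automorphisms given by $\gamma_g(a)=\lambda_\sigma(g)\,a\,\lambda_\sigma(g)^*$. Call $g\in G$ $\sigma$-regular if $\sigma(g,h)=\sigma(h,g)$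 for every $h\in G$ commuting with $g$, and say that $(G,\sigma)$ satisfies Kleppner's condition if the conjugacy class of every $\sigma$-regular element $g\neq e$ is infinite. Then the following conditions are equivalent: (i) $(G,\sigma)$ satisfies Kleppner's condition; (ii) $\tau_{FC}$ is the unique $\gamma$-invariant tracial state of $A_{FC}$ (that is, $\tau_{FC}$ is a $\gamma$-invariant tracial state, and every $\gamma$-invariant tracial state of $A_{FC}$ equals $\tau_{FC}$). -/

import Mathlib

open scoped ComplexOrder ENNReal

noncomputable section

namespace TwistedGroup

/-- A normalized two-cocycle on the group `G` with values in the circle group. -/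
structure TwoCocycle (G : Type*) [Group G] where
  toFun : G → G → Circle
  cocycle : ∀ g h k : G, toFun g h * toFun (g * h) k = toFun h k * toFun g (h * k)
  map_one_right : ∀ g : G, toFun g 1 = 1
  map_one_left : ∀ g : G, toFun 1 g = 1

instance {G : Type*} [Group G] : CoeFun (TwoCocycle G) (fun _ => G → G → Circle) :=
  ⟨TwoCocycle.toFun⟩

/-- `g` is `σ`-regular if `σ(g,h) = σ(h,g)` for every `h` commuting with `g`. -/
def IsRegular {G : Type*} [Group G] (σ : TwoCocycle G) (g : G) : Prop :=
  ∀ h : G, h * g = g * h → σ g h = σ h g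

/-- Kleppner's condition: every nontrivial `σ`-regular conjugacy class is infinite. -/
def KleppnerCondition {G : Type*} [Group G] (σ : TwoCocycle G) : Prop :=
  ∀ g : G, g ≠ 1 → IsRegular σ g → (conjugatesOf g).Infinite

/-- The FC-center of `G`: all elements whose conjugacy class is finite. -/
def FCCenter (G : Type*) [Group G] : Subgroup G where
  carrier := {g | (conjugatesOf g).Finite}
  one_mem' := by
    refine (Set.finite_singleton (1 : G)).subset ?_
    intro x hx
    obtain ⟨c, rfl⟩ := isConj_iff.1 (show IsConj 1 x from hx)
    simp
  mul_mem' := by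
    intro a b ha hb
    refine (Set.Finite.image2 (fun x y => x * y) ha hb).subset ?_
    intro x hx
    obtain ⟨c, rfl⟩ := isConj_iff.1 (show IsConj (a * b) x from hx)
    exact ⟨c * a * c⁻¹, isConj_iff.2 ⟨c, rfl⟩, c * b * c⁻¹, isConj_iff.2 ⟨c, rfl⟩, by group⟩
  inv_mem' := by
    intro a ha
    refine (Set.Finite.image (fun x => x⁻¹) ha).subset ?_
    intro x hx
    obtain ⟨c, rfl⟩ := isConj_iff.1 (show IsConj a⁻¹ x from hx)
    exact ⟨c * a * c⁻¹, isConj_iff.2 ⟨c, rfl⟩, by simp [mul_assoc]⟩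

theorem FCCenter_conj_mem {G : Type*} [Group G] {h : G} (hh : h ∈ FCCenter G) (g : G) :
    g * h * g⁻¹ ∈ FCCenter G := by
  have e : conjugatesOf (g * h * g⁻¹) = conjugatesOf h :=
    (IsConj.conjugatesOf_eq (isConj_iff.2 ⟨g, rfl⟩)).symm
  change (conjugatesOf (g * h * g⁻¹)).Finite
  rw [e]
  exact hh

/-- The Hilbert space `ℓ²(G)`. -/
abbrev L2 (G : Type*) : Type _ := lp (fun _ : G => ℂ) 2

/-- The operator `(λ_σ(g) ξ)(h) = σ(g, g⁻¹h) ξ(g⁻¹h)` on `ℓ²(G)`, as a linear isometry. -/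
def lambdaIsometry {G : Type*} [Group G] (σ : TwoCocycle G) (g : G) : L2 G →ₗᵢ[ℂ] L2 G where
  toFun ξ := ⟨fun h => (σ g (g⁻¹ * h) : ℂ) * ξ (g⁻¹ * h), by
    have h2 : (0 : ℝ) < (2 : ℝ≥0∞).toReal := by norm_num
    have hs := (Equiv.mulLeft g⁻¹).summable_iff.2 ((memℓp_gen_iff h2).1 (lp.memℓp ξ))
    refine (memℓp_gen_iff h2).2 ?_
    simpa [Function.comp_def, Circle.norm_coe] using hs⟩
  map_add' ξ η := by
    ext h
    exact mul_add _ _ _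
  map_smul' c ξ := by
    ext h
    exact mul_left_comm _ _ _
  norm_map' ξ := by
    have h2 : (0 : ℝ) < (2 : ℝ≥0∞).toReal := by norm_num
    rw [lp.norm_eq_tsum_rpow h2, lp.norm_eq_tsum_rpow h2,
      ← (Equiv.mulLeft g⁻¹).tsum_eq (fun i => ‖ξ i‖ ^ (2 : ℝ≥0∞).toReal)]
    simp [Circle.norm_coe]

theorem lambdaIsometry_apply {G : Type*} [Group G] (σ : TwoCocycle G) (g : G) (ξ : L2 G) (h : G) :
    lambdaIsometry σ g ξ h = (σ g (g⁻¹ * h) : ℂ) * ξ (g⁻¹ * h) := rfl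

theorem lambdaIsometry_mul {G : Type*} [Group G] (σ : TwoCocycle G) (g h : G) (ξ : L2 G) :
    lambdaIsometry σ g (lambdaIsometry σ h ξ) = (σ g h : ℂ) • lambdaIsometry σ (g * h) ξ := by
  ext k
  have hc := σ.cocycle g h (h⁻¹ * (g⁻¹ * k))
  rw [mul_inv_cancel_left] at hc
  have hc' : (σ g h : ℂ) * (σ (g * h) (h⁻¹ * (g⁻¹ * k)) : ℂ)
      = (σ h (h⁻¹ * (g⁻¹ * k)) : ℂ) * (σ g (g⁻¹ * k) : ℂ) := by
    rw [← Circle.coe_mul, hc, Circle.coe_mul]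
  simp only [lambdaIsometry_apply, lp.coeFn_smul, Pi.smul_apply, smul_eq_mul, mul_inv_rev,
    mul_assoc]
  rw [← mul_assoc (σ g h : ℂ), hc']
  ring

theorem lambdaIsometry_one {G : Type*} [Group G] (σ : TwoCocycle G) (ξ : L2 G) :
    lambdaIsometry σ 1 ξ = ξ := by
  ext k
  simp [lambdaIsometry_apply, σ.map_one_left]

theorem lambdaIsometry_surjective {G : Type*} [Group G] (σ : TwoCocycle G) (g : G) :
    Function.Surjective (lambdaIsometry σ g) := by
  intro ξ
  refine ⟨(σ g g⁻¹ : ℂ)⁻¹ • lambdaIsometry σ g⁻¹ ξ, ?_⟩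
  rw [map_smul, lambdaIsometry_mul, mul_inv_cancel, lambdaIsometry_one, smul_smul,
    inv_mul_cancel₀ (Circle.coe_ne_zero _), one_smul]

/-- The left regular `σ`-projective unitary representation of `G` on `ℓ²(G)`. -/
def lambda {G : Type*} [Group G] (σ : TwoCocycle G) (g : G) : unitary (L2 G →L[ℂ] L2 G) :=
  Unitary.linearIsometryEquiv.symm
    (LinearIsometryEquiv.ofSurjective (lambdaIsometry σ g) (lambdaIsometry_surjective σ g))

theorem lambda_apply {G : Type*} [Group G] (σ : TwoCocycle G) (g : G) (ξ : L2 G) (h : G) :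
    (lambda σ g : L2 G →L[ℂ] L2 G) ξ h = (σ g (g⁻¹ * h) : ℂ) * ξ (g⁻¹ * h) := rfl

theorem lambda_mul {G : Type*} [Group G] (σ : TwoCocycle G) (g h : G) :
    (lambda σ g : L2 G →L[ℂ] L2 G) * (lambda σ h : L2 G →L[ℂ] L2 G)
      = (σ g h : ℂ) • (lambda σ (g * h) : L2 G →L[ℂ] L2 G) :=
  ContinuousLinearMap.ext fun ξ => lambdaIsometry_mul σ g h ξ

theorem lambda_one {G : Type*} [Group G] (σ : TwoCocycle G) : lambda σ 1 = 1 :=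
  Subtype.ext (ContinuousLinearMap.ext fun ξ => lambdaIsometry_one σ ξ)

/-- The reduced twisted group C*-algebra `C*_r(G,σ)`: the norm-closed `*`-subalgebra of
`B(ℓ²(G))` generated by `λ_σ(G)`. -/
def reducedCStar {G : Type*} [Group G] (σ : TwoCocycle G) : StarSubalgebra ℂ (L2 G →L[ℂ] L2 G) :=
  (StarAlgebra.adjoin ℂ
    (Set.range fun g : G => (lambda σ g : L2 G →L[ℂ] L2 G))).topologicalClosure

/-- The C*-subalgebra `A_FC` of `C*_r(G,σ)` generated by `λ_σ(FC(G))`. -/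
def AFC {G : Type*} [Group G] (σ : TwoCocycle G) : StarSubalgebra ℂ (L2 G →L[ℂ] L2 G) :=
  (StarAlgebra.adjoin ℂ
    ((fun g : G => (lambda σ g : L2 G →L[ℂ] L2 G)) '' (FCCenter G : Set G))).topologicalClosure

theorem AFC_le {G : Type*} [Group G] (σ : TwoCocycle G) : AFC σ ≤ reducedCStar σ :=
  StarSubalgebra.topologicalClosure_mono (StarAlgebra.adjoin_mono (Set.image_subset_range _ _))

/-- A tracial state of a unital C*-algebra: a linear functional that is positive, unital
and tracial. -/
structure IsTracialState {A : Type*} [Ring A] [StarRing A] [Algebra ℂ A] (φ : A →ₗ[ℂ] ℂ) :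
    Prop where
  nonneg : ∀ a : A, 0 ≤ φ (star a * a)
  map_one : φ 1 = 1
  tracial : ∀ a b : A, φ (a * b) = φ (b * a)

/-- The vector `δ_e` of `ℓ²(G)`. -/
def deltaOne (G : Type*) [Group G] : L2 G := by
  classical exact lp.single 2 (1 : G) (1 : ℂ)

/-- The canonical tracial state `τ(a) = ⟨a δ_e, δ_e⟩` on `C*_r(G,σ)`. (The inner product
`inner ℂ` is linear in its second argument.) -/
def canonicalTrace {G : Type*} [Group G] (σ : TwoCocycle G) : reducedCStar σ →ₗ[ℂ] ℂ where
  toFun a := inner ℂ (deltaOne G) ((a : L2 G →L[ℂ] L2 G) (deltaOne G))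
  map_add' a b := by simp
  map_smul' c a := by simp

/-- The restriction `τ_FC` of the canonical trace to `A_FC`. -/
def traceFC {G : Type*} [Group G] (σ : TwoCocycle G) : AFC σ →ₗ[ℂ] ℂ :=
  canonicalTrace σ ∘ₗ (StarSubalgebra.inclusion (AFC_le σ)).toAlgHom.toLinearMap

theorem traceFC_apply {G : Type*} [Group G] (σ : TwoCocycle G) (a : AFC σ) :
    traceFC σ a = inner ℂ (deltaOne G) ((a : L2 G →L[ℂ] L2 G) (deltaOne G)) := rfl

/-- `λ_σ(g) λ_σ(h) λ_σ(g)* = σ(g,h) conj(σ(ghg⁻¹,g)) λ_σ(ghg⁻¹)`. -/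
theorem lambda_conj {G : Type*} [Group G] (σ : TwoCocycle G) (g h : G) :
    (lambda σ g : L2 G →L[ℂ] L2 G) * (lambda σ h : L2 G →L[ℂ] L2 G)
        * star (lambda σ g : L2 G →L[ℂ] L2 G)
      = ((σ g h : ℂ) * (σ (g * h * g⁻¹) g : ℂ)⁻¹) •
        (lambda σ (g * h * g⁻¹) : L2 G →L[ℂ] L2 G) := by
  have h1 := lambda_mul σ (g * h * g⁻¹) g
  rw [inv_mul_cancel_right] at h1
  have h2 : (lambda σ (g * h) : L2 G →L[ℂ] L2 G) = (σ (g * h * g⁻¹) g : ℂ)⁻¹ •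
      ((lambda σ (g * h * g⁻¹) : L2 G →L[ℂ] L2 G) * (lambda σ g : L2 G →L[ℂ] L2 G)) := by
    rw [h1, smul_smul, inv_mul_cancel₀ (Circle.coe_ne_zero _), one_smul]
  rw [lambda_mul, h2, smul_smul, smul_mul_assoc,
    mul_assoc (lambda σ (g * h * g⁻¹) : L2 G →L[ℂ] L2 G),
    Unitary.mul_star_self_of_mem (lambda σ g).2, mul_one]

theorem conj_mem_AFC {G : Type*} [Group G] (σ : TwoCocycle G) (g : G)
    {a : L2 G →L[ℂ] L2 G} (ha : a ∈ AFC σ) :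
    Unitary.conjStarAlgAut ℂ (L2 G →L[ℂ] L2 G) (lambda σ g) a ∈ AFC σ := by
  let f : (L2 G →L[ℂ] L2 G) →⋆ₐ[ℂ] (L2 G →L[ℂ] L2 G) :=
    ((Unitary.conjStarAlgAut ℂ (L2 G →L[ℂ] L2 G) (lambda σ g) :
      (L2 G →L[ℂ] L2 G) ≃⋆ₐ[ℂ] (L2 G →L[ℂ] L2 G)) : _ →⋆ₐ[ℂ] _)
  have hf : Continuous f := by
    change Continuous fun x : L2 G →L[ℂ] L2 G =>
      (lambda σ g : L2 G →L[ℂ] L2 G) * x * star (lambda σ g : L2 G →L[ℂ] L2 G)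
    fun_prop
  have key : AFC σ ≤ (AFC σ).comap f := by
    refine StarSubalgebra.topologicalClosure_minimal (StarAlgebra.adjoin_le ?_)
      ((StarSubalgebra.isClosed_topologicalClosure _).preimage hf)
    rintro _ ⟨h, hh, rfl⟩
    change (lambda σ g : L2 G →L[ℂ] L2 G) * (lambda σ h : L2 G →L[ℂ] L2 G)
        * star (lambda σ g : L2 G →L[ℂ] L2 G) ∈ AFC σ
    rw [lambda_conj]
    exact (AFC σ).smul_mem (StarSubalgebra.le_topologicalClosure _
      (StarAlgebra.subset_adjoin _ _ ⟨_, FCCenter_conj_mem hh g, rfl⟩)) _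
  exact key ha

/-- The `*`-endomorphism `a ↦ λ_σ(g) a λ_σ(g)*` of `A_FC`. -/
def gammaHom {G : Type*} [Group G] (σ : TwoCocycle G) (g : G) : AFC σ →⋆ₐ[ℂ] AFC σ where
  toFun a := ⟨(lambda σ g : L2 G →L[ℂ] L2 G) * a * star (lambda σ g : L2 G →L[ℂ] L2 G),
    conj_mem_AFC σ g a.2⟩
  map_one' := Subtype.ext (map_one (Unitary.conjStarAlgAut ℂ (L2 G →L[ℂ] L2 G) (lambda σ g)))
  map_mul' a b := Subtype.ext
    (map_mul (Unitary.conjStarAlgAut ℂ (L2 G →L[ℂ] L2 G) (lambda σ g)) a.1 b.1)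
  map_zero' := Subtype.ext (map_zero (Unitary.conjStarAlgAut ℂ (L2 G →L[ℂ] L2 G) (lambda σ g)))
  map_add' a b := Subtype.ext
    (map_add (Unitary.conjStarAlgAut ℂ (L2 G →L[ℂ] L2 G) (lambda σ g)) a.1 b.1)
  commutes' c := Subtype.ext (by
    change (lambda σ g : L2 G →L[ℂ] L2 G) * algebraMap ℂ (L2 G →L[ℂ] L2 G) c
      * star (lambda σ g : L2 G →L[ℂ] L2 G) = algebraMap ℂ (L2 G →L[ℂ] L2 G) c
    rw [← Algebra.commutes, mul_assoc, Unitary.mul_star_self_of_mem (lambda σ g).2, mul_one])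
  map_star' a := Subtype.ext
    (map_star (Unitary.conjStarAlgAut ℂ (L2 G →L[ℂ] L2 G) (lambda σ g)) a.1)

theorem gammaHom_one {G : Type*} [Group G] (σ : TwoCocycle G) (a : AFC σ) :
    gammaHom σ 1 a = a :=
  Subtype.ext (by simp [gammaHom, lambda_one])

theorem gammaHom_mul {G : Type*} [Group G] (σ : TwoCocycle G) (g h : G) (a : AFC σ) :
    gammaHom σ (g * h) a = gammaHom σ g (gammaHom σ h a) := by
  apply Subtype.ext
  have hne : (σ g h : ℂ) ≠ 0 := Circle.coe_ne_zero _
  have h2 : (lambda σ (g * h) : L2 G →L[ℂ] L2 G) = (σ g h : ℂ)⁻¹ •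
      ((lambda σ g : L2 G →L[ℂ] L2 G) * (lambda σ h : L2 G →L[ℂ] L2 G)) := by
    rw [lambda_mul, smul_smul, inv_mul_cancel₀ hne, one_smul]
  have h3 : (σ g h : ℂ)⁻¹ * star (σ g h : ℂ)⁻¹ = 1 := by
    rw [← Circle.coe_inv, ← starRingEnd_apply, ← Circle.coe_inv_eq_conj, ← Circle.coe_mul,
      mul_inv_cancel, Circle.coe_one]
  change (lambda σ (g * h) : L2 G →L[ℂ] L2 G) * a * star (lambda σ (g * h) : L2 G →L[ℂ] L2 G)
    = (lambda σ g : L2 G →L[ℂ] L2 G) * ((lambda σ h : L2 G →L[ℂ] L2 G) * a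
      * star (lambda σ h : L2 G →L[ℂ] L2 G)) * star (lambda σ g : L2 G →L[ℂ] L2 G)
  rw [h2, star_smul, star_mul, smul_mul_assoc, smul_mul_assoc, mul_smul_comm, smul_smul, h3,
    one_smul]
  simp only [mul_assoc]

/-- The action `γ` of `G` on `A_FC` by `*`-automorphisms, `γ_g(a) = λ_σ(g) a λ_σ(g)*`. -/
def gamma {G : Type*} [Group G] (σ : TwoCocycle G) : G →* (AFC σ ≃⋆ₐ[ℂ] AFC σ) where
  toFun g := StarAlgEquiv.ofStarAlgHom (gammaHom σ g) (gammaHom σ g⁻¹)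
    (StarAlgHom.ext fun a => by
      change gammaHom σ g⁻¹ (gammaHom σ g a) = a
      rw [← gammaHom_mul, inv_mul_cancel, gammaHom_one])
    (StarAlgHom.ext fun a => by
      change gammaHom σ g (gammaHom σ g⁻¹ a) = a
      rw [← gammaHom_mul, mul_inv_cancel, gammaHom_one])
  map_one' := StarAlgEquiv.ext fun a => gammaHom_one σ a
  map_mul' g h := StarAlgEquiv.ext fun a => gammaHom_mul σ g h a

theorem gamma_apply {G : Type*} [Group G] (σ : TwoCocycle G) (g : G) (a : AFC σ) :
    (gamma σ g a : L2 G →L[ℂ] L2 G)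
      = (lambda σ g : L2 G →L[ℂ] L2 G) * a * star (lambda σ g : L2 G →L[ℂ] L2 G) := rfl

/-- A linear functional `φ` on `A_FC` is `γ`-invariant if `φ ∘ γ_g = φ` for all `g`. -/
def IsGammaInvariant {G : Type*} [Group G] (σ : TwoCocycle G) (φ : AFC σ →ₗ[ℂ] ℂ) : Prop :=
  ∀ (g : G) (a : AFC σ), φ (gamma σ g a) = φ a

end TwistedGroup

end

open scoped ComplexOrder ENNReal

noncomputable section

namespace TwistedGroup

variable {G : Type*} [Group G] (σ : TwoCocycle G)

/-! The elements `λ_σ(g)`, `g ∈ FC(G)`, span a dense subspace of `A_FC`, so a continuous functional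
is determined by its values on them; `τ_FC` is 1 at `g = e` and 0 elsewhere. If `h` commutes with
`g`, then `γ_h` multiplies `λ_σ(g)` by `σ(g,h)`-versus-`σ(h,g)`, a scalar different from 1 for some
such `h` exactly when `g` is not `σ`-regular. Under Kleppner's condition every nontrivial `g ∈
FC(G)` is non-regular, so an invariant state vanishes on `λ_σ(g)` and equals `τ_FC`
(`eq_traceFC_of_kleppner`). Conversely, a nontrivial regular `g` with finite class has a finite
`γ`-orbit of `λ_σ(g)`, whose sum `z` is fixed, central and of trace zero, with `z δ_e ≠ 0`.
Perturbing `τ_FC` by the density `1 + c w`, with `w` the real or imaginary part of `z` and `c > 0`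
small, gives invariant tracial states; uniqueness would force `z δ_e = 0`
(`apply_deltaOne_eq_zero_of_unique`). -/

theorem isClosed_AFC : IsClosed (AFC σ : Set (L2 G →L[ℂ] L2 G)) :=
  StarSubalgebra.isClosed_topologicalClosure _

/-! ### Density of the span of `λ_σ(FC(G))` -/

theorem lambda_mem_AFC {g : G} (hg : g ∈ FCCenter G) :
    (lambda σ g : L2 G →L[ℂ] L2 G) ∈ AFC σ :=
  StarSubalgebra.le_topologicalClosure _ (StarAlgebra.subset_adjoin _ _ ⟨g, hg, rfl⟩)

/-- The canonical unitary `λ_σ(g)` as an element of `A_FC`. -/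
def lambdaFC (g : FCCenter G) : AFC σ := ⟨lambda σ (g : G), lambda_mem_AFC σ g.2⟩

theorem lambdaFC_mul (g h : FCCenter G) :
    lambdaFC σ g * lambdaFC σ h = (σ g h : ℂ) • lambdaFC σ (g * h) :=
  Subtype.ext (lambda_mul σ g h)

theorem lambdaFC_one : lambdaFC σ 1 = 1 :=
  Subtype.ext (by simp [lambdaFC, lambda_one])

theorem star_lambda (g : G) :
    star (lambda σ g : L2 G →L[ℂ] L2 G)
      = (σ g g⁻¹ : ℂ)⁻¹ • (lambda σ g⁻¹ : L2 G →L[ℂ] L2 G) := by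
  have h := lambda_mul σ g g⁻¹
  rw [mul_inv_cancel, lambda_one] at h
  have h2 := congrArg (fun x => star (lambda σ g : L2 G →L[ℂ] L2 G) * x) h
  simp only [← mul_assoc, Unitary.star_mul_self_of_mem (lambda σ g).2, one_mul, mul_smul_comm,
    OneMemClass.coe_one, mul_one] at h2
  rw [h2, smul_smul, inv_mul_cancel₀ (Circle.coe_ne_zero _), one_smul]

/-- The linear span of `λ_σ(FC(G))` is a `*`-subalgebra. -/
def spanFC : StarSubalgebra ℂ (L2 G →L[ℂ] L2 G) where
  carrier := Submodule.span ℂ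
    (Set.range fun g : FCCenter G => (lambda σ (g : G) : L2 G →L[ℂ] L2 G))
  mul_mem' {a b} ha hb := by
    have h := Submodule.mul_mem_mul ha hb
    rw [Submodule.span_mul_span] at h
    refine Submodule.span_le.2 ?_ h
    rintro _ ⟨_, ⟨g, rfl⟩, _, ⟨h, rfl⟩, rfl⟩
    simp only [lambda_mul]
    exact Submodule.smul_mem _ _ (Submodule.subset_span ⟨g * h, rfl⟩)
  add_mem' ha hb := Submodule.add_mem _ ha hb
  algebraMap_mem' c := by
    rw [Algebra.algebraMap_eq_smul_one]
    exact Submodule.smul_mem _ _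
      (Submodule.subset_span ⟨1, congrArg Subtype.val (lambda_one σ)⟩)
  star_mem' {a} ha := by
    induction ha using Submodule.span_induction with
    | mem x hx =>
      obtain ⟨g, rfl⟩ := hx
      simp only [star_lambda]
      exact Submodule.smul_mem _ _ (Submodule.subset_span ⟨g⁻¹, rfl⟩)
    | zero => rw [star_zero]; exact Submodule.zero_mem _
    | add x y _ _ hx hy => rw [star_add]; exact Submodule.add_mem _ hx hy
    | smul c x _ hx => rw [star_smul]; exact Submodule.smul_mem _ _ hx

/-- A closed subspace of `A_FC` containing all `λ_σ(g)` is everything. -/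
theorem mem_of_lambdaFC_mem (p : Submodule ℂ (AFC σ)) (hp : IsClosed (p : Set (AFC σ)))
    (h : ∀ g, lambdaFC σ g ∈ p) (a : AFC σ) : a ∈ p := by
  -- The closure defining `A_FC` is taken in `B(ℓ²(G))`, so `p` has to be closed there too.
  have hcl : IsClosed (Subtype.val '' (p : Set (AFC σ)) : Set (L2 G →L[ℂ] L2 G)) :=
    (isClosed_AFC σ).isClosedEmbedding_subtypeVal.isClosedMap _ hp
  have hspan : (spanFC σ : Set (L2 G →L[ℂ] L2 G)) ⊆ Subtype.val '' (p : Set (AFC σ)) := by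
    have : Submodule.span ℂ
        (Set.range fun g : FCCenter G => (lambda σ (g : G) : L2 G →L[ℂ] L2 G))
        ≤ p.map (AFC σ).subtype.toAlgHom.toLinearMap := by
      refine Submodule.span_le.2 ?_
      rintro _ ⟨g, rfl⟩
      exact ⟨lambdaFC σ g, h g, rfl⟩
    exact this
  have hadj : StarAlgebra.adjoin ℂ
      ((fun g : G => (lambda σ g : L2 G →L[ℂ] L2 G)) '' (FCCenter G : Set G)) ≤ spanFC σ := by
    refine StarAlgebra.adjoin_le ?_
    rintro _ ⟨g, hg, rfl⟩
    exact Submodule.subset_span ⟨⟨g, hg⟩, rfl⟩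
  obtain ⟨b, hb, hba⟩ := closure_minimal (Set.Subset.trans hadj hspan) hcl a.2
  rwa [← Subtype.ext hba]

/-- Continuous linear maps on `A_FC` are determined by their values on the `λ_σ(g)`. -/
theorem linearMap_ext_lambdaFC {E : Type*} [AddCommGroup E] [Module ℂ E] [TopologicalSpace E]
    [T2Space E] {f f' : AFC σ →ₗ[ℂ] E} (hf : Continuous f) (hf' : Continuous f')
    (h : ∀ g, f (lambdaFC σ g) = f' (lambdaFC σ g)) : f = f' :=
  LinearMap.ext fun a => mem_of_lambdaFC_mem σ (LinearMap.eqLocus f f') (isClosed_eq hf hf') h a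

/-! ### The canonical trace is an invariant tracial state -/

theorem traceFC_eq_coeff (a : AFC σ) :
    traceFC σ a = (a : L2 G →L[ℂ] L2 G) (deltaOne G) 1 := by
  classical
  rw [traceFC_apply, deltaOne, lp.inner_single_left]
  simp

theorem continuous_traceFC : Continuous (traceFC σ) := by
  exact (innerSL ℂ (deltaOne G)).continuous.comp
    ((ContinuousLinearMap.apply ℂ (L2 G) (deltaOne G)).continuous.comp continuous_subtype_val)

theorem lambda_deltaOne (g h : G) [Decidable (h = g)] :
    (lambda σ g : L2 G →L[ℂ] L2 G) (deltaOne G) h = if h = g then 1 else 0 := by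
  classical
  rw [lambda_apply, deltaOne, lp.single_apply]
  split_ifs with hgh
  · simp [hgh, σ.map_one_right]
  · have : g⁻¹ * h ≠ 1 := fun e => hgh (inv_mul_eq_one.1 e).symm
    simp [this]

theorem traceFC_lambdaFC (g : FCCenter G) [Decidable (g = 1)] :
    traceFC σ (lambdaFC σ g) = if g = 1 then 1 else 0 := by
  classical
  rw [traceFC_eq_coeff, lambdaFC, lambda_deltaOne]
  exact if_congr (by rw [← Subgroup.coe_one (FCCenter G), Subtype.coe_inj, eq_comm]) rfl rfl

theorem TwoCocycle.apply_inv_comm (g : G) : σ g g⁻¹ = σ g⁻¹ g := by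
  simpa [σ.map_one_left, σ.map_one_right] using σ.cocycle g g⁻¹ g

/-- Density in each variable reduces this to generators, where only `h = g⁻¹` contributes and
`σ(g,g⁻¹) = σ(g⁻¹,g)`. -/
theorem traceFC_mul_comm (a b : AFC σ) : traceFC σ (a * b) = traceFC σ (b * a) := by
  classical
  have hcont := continuous_traceFC σ
  have key : (traceFC σ) ∘ₗ LinearMap.mulLeft ℂ a = (traceFC σ) ∘ₗ LinearMap.mulRight ℂ a := by
    refine linearMap_ext_lambdaFC σ (hcont.comp (continuous_const_mul a))
      (hcont.comp (continuous_mul_const a)) fun g => ?_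
    have key2 : (traceFC σ) ∘ₗ LinearMap.mulRight ℂ (lambdaFC σ g)
        = (traceFC σ) ∘ₗ LinearMap.mulLeft ℂ (lambdaFC σ g) := by
      refine linearMap_ext_lambdaFC σ (hcont.comp (continuous_mul_const _))
        (hcont.comp (continuous_const_mul _)) fun h => ?_
      change traceFC σ (lambdaFC σ h * lambdaFC σ g) = traceFC σ (lambdaFC σ g * lambdaFC σ h)
      rw [lambdaFC_mul, lambdaFC_mul, map_smul, map_smul, traceFC_lambdaFC, traceFC_lambdaFC]
      by_cases hgh : g * h = 1
      · obtain rfl := eq_inv_of_mul_eq_one_right hgh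
        simp [TwoCocycle.apply_inv_comm]
      · rw [if_neg hgh, if_neg (mt mul_eq_one_comm.1 hgh), smul_zero, smul_zero]
    exact LinearMap.congr_fun key2 a
  exact LinearMap.congr_fun key b

theorem traceFC_star_mul_mul (a p : AFC σ) :
    traceFC σ (star a * p * a)
      = inner ℂ ((a : L2 G →L[ℂ] L2 G) (deltaOne G))
          ((p : L2 G →L[ℂ] L2 G) ((a : L2 G →L[ℂ] L2 G) (deltaOne G))) := by
  rw [traceFC_apply]
  exact ContinuousLinearMap.adjoint_inner_right (a : L2 G →L[ℂ] L2 G) _ _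

theorem traceFC_star_mul (a : AFC σ) :
    traceFC σ (star a * a) = ((‖(a : L2 G →L[ℂ] L2 G) (deltaOne G)‖ ^ 2 : ℝ) : ℂ) := by
  have h := traceFC_star_mul_mul σ a 1
  rw [mul_one] at h
  rw [h]
  simp

theorem isTracialState_traceFC : IsTracialState (traceFC σ) where
  nonneg a := by
    rw [traceFC_star_mul]
    exact Complex.zero_le_real.2 (sq_nonneg _)
  map_one := by
    classical
    rw [← lambdaFC_one, traceFC_lambdaFC, if_pos rfl]
  tracial := traceFC_mul_comm σ

theorem gamma_lambdaFC (g : G) (h : FCCenter G) :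
    gamma σ g (lambdaFC σ h) = ((σ g h : ℂ) * (σ (g * h * g⁻¹) g : ℂ)⁻¹) •
      lambdaFC σ ⟨g * h * g⁻¹, FCCenter_conj_mem h.2 g⟩ :=
  Subtype.ext (lambda_conj σ g h)

theorem gamma_mul (g : G) (a b : AFC σ) : gamma σ g (a * b) = gamma σ g a * gamma σ g b :=
  map_mul (gamma σ g) a b

theorem gamma_star (g : G) (a : AFC σ) : gamma σ g (star a) = star (gamma σ g a) :=
  (gamma σ g).map_star' a

theorem continuous_gamma (g : G) : Continuous (gamma σ g) := by
  refine continuous_induced_rng.2 ?_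
  change Continuous fun a : AFC σ =>
    (lambda σ g : L2 G →L[ℂ] L2 G) * (a : L2 G →L[ℂ] L2 G) * star (lambda σ g : L2 G →L[ℂ] L2 G)
  fun_prop

theorem isGammaInvariant_traceFC : IsGammaInvariant σ (traceFC σ) := by
  classical
  intro g a
  have key : (traceFC σ) ∘ₗ (gammaHom σ g).toAlgHom.toLinearMap
      = traceFC σ := by
    refine linearMap_ext_lambdaFC σ ((continuous_traceFC σ).comp (continuous_gamma σ g))
      (continuous_traceFC σ) fun h => ?_
    change traceFC σ (gamma σ g (lambdaFC σ h)) = _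
    by_cases hh : h = 1
    · rw [hh, lambdaFC_one, map_one]
    · rw [gamma_lambdaFC, map_smul, traceFC_lambdaFC, traceFC_lambdaFC, if_neg hh, if_neg,
        smul_zero]
      intro e
      exact hh (Subtype.ext (conj_eq_one_iff.1 (congrArg Subtype.val e)))
  exact LinearMap.congr_fun key a

/-! ### Kleppner's condition implies uniqueness -/

/-- Positive elements of a C*-algebra are those of the form `b* b`, and positive functionals are
automatically continuous. -/
theorem IsTracialState.continuous {A : Type*} [CStarAlgebra A] {φ : A →ₗ[ℂ] ℂ}
    (hφ : IsTracialState φ) : Continuous φ := by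
  let _ := CStarAlgebra.spectralOrder A
  have _ := CStarAlgebra.spectralOrderedRing A
  let f : A →ₚ[ℂ] ℂ := PositiveLinearMap.mk₀ φ fun x hx => by
    obtain ⟨b, rfl⟩ := CStarAlgebra.nonneg_iff_eq_star_mul_self.1 hx
    exact hφ.nonneg b
  exact map_continuous f

theorem gamma_lambdaFC_of_commute {g : G} {h : FCCenter G} (hgh : g * h = h * g) :
    gamma σ g (lambdaFC σ h) = ((σ g h : ℂ) * (σ h g : ℂ)⁻¹) • lambdaFC σ h := by
  apply Subtype.ext
  have := lambda_conj σ g h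
  rw [hgh, mul_inv_cancel_right] at this
  exact this

theorem eq_traceFC_of_kleppner (hK : KleppnerCondition σ) {φ : AFC σ →ₗ[ℂ] ℂ}
    (hφ : IsTracialState φ) (hinv : IsGammaInvariant σ φ) : φ = traceFC σ := by
  classical
  -- Closedness makes `A_FC` a C*-algebra, as automatic continuity requires.
  have := isClosed_AFC σ
  refine linearMap_ext_lambdaFC σ (IsTracialState.continuous hφ) (continuous_traceFC σ)
    fun g => ?_
  rw [traceFC_lambdaFC]
  split_ifs with hg
  · rw [hg, lambdaFC_one, hφ.map_one]
  · have hreg : ¬ IsRegular σ (g : G) := fun hr =>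
      hK g (fun e => hg (Subtype.ext e)) hr g.2
    simp only [IsRegular, not_forall] at hreg
    obtain ⟨h, hcomm, hne⟩ := hreg
    have h1 := hinv h (lambdaFC σ g)
    rw [gamma_lambdaFC_of_commute σ hcomm, map_smul, smul_eq_mul] at h1
    by_contra h0
    have h2 := mul_right_cancel₀ h0 (h1.trans (one_mul _).symm)
    rw [mul_inv_eq_one₀ (Circle.coe_ne_zero _)] at h2
    exact hne (Circle.ext h2).symm

/-! ### Perturbing the trace by fixed elements -/

/-- Being fixed by `γ_g` means commuting with `λ_σ(g)`, and these generate `A_FC`. -/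
theorem mul_comm_of_gamma_fixed {z : AFC σ} (hz : ∀ g, gamma σ g z = z) (a : AFC σ) :
    a * z = z * a := by
  have key : LinearMap.mulRight ℂ z = LinearMap.mulLeft ℂ z := by
    refine linearMap_ext_lambdaFC σ (continuous_mul_const z) (continuous_const_mul z)
      fun g => Subtype.ext ?_
    have h := congrArg
      (fun x : AFC σ => (x : L2 G →L[ℂ] L2 G) * (lambda σ (g : G) : L2 G →L[ℂ] L2 G)) (hz g)
    simp only [gamma_apply, mul_assoc, Unitary.star_mul_self_of_mem (lambda σ (g : G)).2,
      mul_one] at h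
    exact h
  exact LinearMap.congr_fun key a

theorem inner_add_smul_nonneg {H : Type*} [NormedAddCommGroup H] [InnerProductSpace ℂ H]
    [CompleteSpace H] {T : H →L[ℂ] H} (hT : IsSelfAdjoint T) {c : ℝ} (hc : 0 ≤ c)
    (hcT : c * ‖T‖ ≤ 1) (ξ : H) : 0 ≤ inner ℂ ξ (ξ + (c : ℂ) • T ξ) := by
  have hsym := ContinuousLinearMap.isSelfAdjoint_iff_isSymmetric.1 hT
  have him : ((inner ℂ ξ (T ξ)).re : ℂ) = inner ℂ ξ (T ξ) := by
    refine Complex.conj_eq_iff_re.1 ?_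
    rw [inner_conj_symm]
    exact hsym ξ ξ
  have hbd : ‖inner ℂ ξ (T ξ)‖ ≤ ‖T‖ * ‖ξ‖ ^ 2 := by
    calc _ ≤ ‖ξ‖ * ‖T ξ‖ := norm_inner_le_norm _ _
      _ ≤ ‖ξ‖ * (‖T‖ * ‖ξ‖) := by
        gcongr
        exact ContinuousLinearMap.le_opNorm _ _
      _ = _ := by ring
  have hre := (abs_le.1 ((Complex.abs_re_le_norm _).trans hbd)).1
  have hself : inner ℂ ξ ξ = ((‖ξ‖ ^ 2 : ℝ) : ℂ) := by simp
  rw [inner_add_right, inner_smul_right, hself, ← him, ← Complex.ofReal_mul,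
    ← Complex.ofReal_add]
  refine Complex.zero_le_real.2 ?_
  have h1 := mul_le_mul_of_nonneg_left hre hc
  have h2 := mul_le_mul_of_nonneg_right hcT (sq_nonneg ‖ξ‖)
  linarith

/-- Centrality of the density `p` gives traciality and rewrites `τ(a* a p)` as `⟨p a δ_e, a δ_e⟩`.
-/
theorem isTracialState_traceFC_mulRight {p : AFC σ} (hcomm : ∀ a, a * p = p * a)
    (hpos : ∀ ξ : L2 G, 0 ≤ inner ℂ ξ ((p : L2 G →L[ℂ] L2 G) ξ)) (hp : traceFC σ p = 1) :
    IsTracialState (traceFC σ ∘ₗ LinearMap.mulRight ℂ p) where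
  nonneg a := by
    change 0 ≤ traceFC σ (star a * a * p)
    rw [mul_assoc, hcomm, ← mul_assoc, traceFC_star_mul_mul]
    exact hpos _
  map_one := by
    change traceFC σ (1 * p) = 1
    rw [one_mul, hp]
  tracial a b := by
    change traceFC σ (a * b * p) = traceFC σ (b * a * p)
    rw [mul_assoc, traceFC_mul_comm, mul_assoc, ← hcomm, ← mul_assoc]

theorem isGammaInvariant_traceFC_mulRight {p : AFC σ} (hfix : ∀ g, gamma σ g p = p) :
    IsGammaInvariant σ (traceFC σ ∘ₗ LinearMap.mulRight ℂ p) := by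
  intro g a
  change traceFC σ (gamma σ g a * p) = traceFC σ (a * p)
  rw [← isGammaInvariant_traceFC σ g (a * p), gamma_mul, hfix]

/-- If `τ_FC` is the unique `γ`-invariant tracial state, then perturbing it by a self-adjoint
`γ`-fixed element `w` of trace zero yields nothing new, so that `w δ_e = 0`. -/
theorem apply_deltaOne_eq_zero_of_star_eq
    (huniq : ∀ φ : AFC σ →ₗ[ℂ] ℂ, IsTracialState φ → IsGammaInvariant σ φ → φ = traceFC σ)
    {w : AFC σ} (hsa : star w = w) (hfix : ∀ g, gamma σ g w = w) (hw : traceFC σ w = 0) :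
    (w : L2 G →L[ℂ] L2 G) (deltaOne G) = 0 := by
  obtain ⟨c, hcpos, hcw⟩ : ∃ c : ℝ, 0 < c ∧ c * ‖(w : L2 G →L[ℂ] L2 G)‖ ≤ 1 := by
    obtain ⟨c, hc, hcw⟩ := exists_pos_mul_lt one_pos ‖(w : L2 G →L[ℂ] L2 G)‖
    exact ⟨c, hc, (mul_comm _ _).trans_le hcw.le⟩
  have hpfix (g : G) : gamma σ g (1 + (c : ℂ) • w) = 1 + (c : ℂ) • w := by
    rw [map_add, map_one, map_smul, hfix]
  have hpos (ξ : L2 G) :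
      0 ≤ inner ℂ ξ (((1 + (c : ℂ) • w : AFC σ) : L2 G →L[ℂ] L2 G) ξ) := by
    have hξ : ((1 + (c : ℂ) • w : AFC σ) : L2 G →L[ℂ] L2 G) ξ
        = ξ + (c : ℂ) • (w : L2 G →L[ℂ] L2 G) ξ := rfl
    have hsa' : IsSelfAdjoint (w : L2 G →L[ℂ] L2 G) := congrArg Subtype.val hsa
    rw [hξ]
    exact inner_add_smul_nonneg hsa' hcpos.le hcw ξ
  have hstate := isTracialState_traceFC_mulRight σ (mul_comm_of_gamma_fixed σ hpfix) hpos
    (by rw [map_add, map_smul, hw, smul_zero, add_zero, (isTracialState_traceFC σ).map_one])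
  -- Testing the two states on `w` itself leaves `c τ(w²) = 0`, and `τ(w²) = ‖w δ_e‖²` since `w` is
  -- self-adjoint.
  have h : traceFC σ (w * (1 + (c : ℂ) • w)) = traceFC σ w :=
    LinearMap.congr_fun (huniq _ hstate (isGammaInvariant_traceFC_mulRight σ hpfix)) w
  rw [mul_add, mul_one, mul_smul_comm, map_add, add_eq_left, map_smul, smul_eq_mul,
    mul_eq_zero_iff_left (by exact_mod_cast hcpos.ne')] at h
  nth_rw 1 [← hsa] at h
  rw [traceFC_star_mul] at h
  exact norm_eq_zero.1 (pow_eq_zero_iff two_ne_zero |>.1 (Complex.ofReal_eq_zero.1 h))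

theorem traceFC_star (a : AFC σ) : traceFC σ (star a) = star (traceFC σ a) := by
  rw [traceFC_apply, traceFC_apply, ← starRingEnd_apply, inner_conj_symm]
  exact ContinuousLinearMap.adjoint_inner_right (a : L2 G →L[ℂ] L2 G) _ _

/-- The version of `apply_deltaOne_eq_zero_of_star_eq` without self-adjointness. -/
theorem apply_deltaOne_eq_zero_of_unique
    (huniq : ∀ φ : AFC σ →ₗ[ℂ] ℂ, IsTracialState φ → IsGammaInvariant σ φ → φ = traceFC σ)
    {z : AFC σ} (hfix : ∀ g, gamma σ g z = z) (hz : traceFC σ z = 0) :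
    (z : L2 G →L[ℂ] L2 G) (deltaOne G) = 0 := by
  have hfix' (g : G) : gamma σ g (star z) = star z := by rw [gamma_star, hfix]
  have h1 := apply_deltaOne_eq_zero_of_star_eq σ huniq (w := z + star z)
    (by rw [star_add, star_star, add_comm]) (fun g => by rw [map_add, hfix, hfix'])
    (by rw [map_add, traceFC_star, hz, star_zero, add_zero])
  have h2 := apply_deltaOne_eq_zero_of_star_eq σ huniq (w := Complex.I • (z - star z))
    (by rw [star_smul, star_sub, star_star, ← starRingEnd_apply, Complex.conj_I, neg_smul,
      ← smul_neg, neg_sub])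
    (fun g => by rw [map_smul, map_sub, hfix, hfix'])
    (by rw [map_smul, map_sub, traceFC_star, hz, star_zero, sub_zero, smul_zero])
  change (z : L2 G →L[ℂ] L2 G) (deltaOne G)
    + (star z : AFC σ).1 (deltaOne G) = 0 at h1
  change Complex.I • ((z : L2 G →L[ℂ] L2 G) (deltaOne G)
    - (star z : AFC σ).1 (deltaOne G)) = 0 at h2
  have h3 := (smul_eq_zero.1 h2).resolve_left Complex.I_ne_zero
  rw [← sub_eq_zero.1 h3, ← two_smul ℂ] at h1
  exact (smul_eq_zero.1 h1).resolve_left two_ne_zero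

/-! ### Uniqueness implies Kleppner's condition -/

/-- Here `k⁻¹h` centralizes `g`, and regularity makes the scalar by which it acts on `λ_σ(g)` equal
to 1. -/
theorem gamma_lambdaFC_eq_of_conj_eq {g : FCCenter G} (hreg : IsRegular σ (g : G)) {h k : G}
    (hk : h * g * h⁻¹ = k * g * k⁻¹) : gamma σ h (lambdaFC σ g) = gamma σ k (lambdaFC σ g) := by
  have hcomm : k⁻¹ * h * (g : G) = g * (k⁻¹ * h) := by
    have := congrArg (fun x => k⁻¹ * x * h) hk
    simpa [mul_assoc] using this
  have hfix : gamma σ (k⁻¹ * h) (lambdaFC σ g) = lambdaFC σ g := by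
    rw [gamma_lambdaFC_of_commute σ hcomm, hreg _ hcomm,
      mul_inv_cancel₀ (Circle.coe_ne_zero _), one_smul]
  conv_rhs => rw [← hfix]
  change _ = (gamma σ k * gamma σ (k⁻¹ * h)) (lambdaFC σ g)
  rw [← map_mul, mul_inv_cancel_left]

theorem finite_range_gamma_lambdaFC {g : FCCenter G} (hreg : IsRegular σ (g : G)) :
    (Set.range fun h : G => gamma σ h (lambdaFC σ g)).Finite := by
  classical
  have hfin : (Set.range fun h : G => h * (g : G) * h⁻¹).Finite := by
    refine Set.Finite.subset g.2 ?_
    rintro _ ⟨h, rfl⟩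
    exact isConj_iff.2 ⟨h, rfl⟩
  have hft : Function.FactorsThrough (fun h : G => gamma σ h (lambdaFC σ g))
      (fun h : G => h * (g : G) * h⁻¹) := fun _ _ hk => gamma_lambdaFC_eq_of_conj_eq σ hreg hk
  have : (Set.range fun h : G => gamma σ h (lambdaFC σ g))
      ⊆ (Function.extend (fun h : G => h * (g : G) * h⁻¹)
          (fun h : G => gamma σ h (lambdaFC σ g)) 0) ''
        (Set.range fun h : G => h * (g : G) * h⁻¹) := by
    rintro _ ⟨h, rfl⟩
    exact ⟨_, ⟨h, rfl⟩, hft.extend_apply _ h⟩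
  exact (hfin.image _).subset this

theorem gamma_lambdaFC_deltaOne_apply {g : FCCenter G} {h k : G} (hk : k ≠ h * g * h⁻¹) :
    (gamma σ h (lambdaFC σ g) : L2 G →L[ℂ] L2 G) (deltaOne G) k = 0 := by
  classical
  rw [gamma_lambdaFC]
  change ((σ h g : ℂ) * (σ (h * g * h⁻¹) h : ℂ)⁻¹) •
    (lambda σ (h * g * h⁻¹) : L2 G →L[ℂ] L2 G) (deltaOne G) k = 0
  rw [lambda_deltaOne, if_neg hk, smul_zero]

/-- Evaluation of `a δ_e` at `k`, as a linear functional of `a`. -/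
def coeffFC (k : G) : AFC σ →ₗ[ℂ] ℂ where
  toFun a := (a : L2 G →L[ℂ] L2 G) (deltaOne G) k
  map_add' _ _ := rfl
  map_smul' _ _ := rfl

theorem kleppner_of_unique
    (huniq : ∀ φ : AFC σ →ₗ[ℂ] ℂ, IsTracialState φ → IsGammaInvariant σ φ → φ = traceFC σ) :
    KleppnerCondition σ := by
  classical
  intro g₀ hg₀ hreg hfin
  let g : FCCenter G := ⟨g₀, hfin⟩
  have hO := finite_range_gamma_lambdaFC σ (g := g) hreg
  -- Summing over distinct orbit elements, not over `G`, keeps the sum finite; each `γ_k` permutes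
  -- them.
  set z : AFC σ := ∑ y ∈ hO.toFinset, y with hz
  have hmem (y : AFC σ) : y ∈ hO.toFinset ↔ ∃ h, gamma σ h (lambdaFC σ g) = y := by
    simp
  have hmul (k h : G) (y : AFC σ) : gamma σ k (gamma σ h y) = gamma σ (k * h) y := by
    rw [map_mul]
    rfl
  have hfix (k : G) : gamma σ k z = z := by
    rw [hz, map_sum]
    refine Finset.sum_bij' (fun y _ => gamma σ k y) (fun y _ => gamma σ k⁻¹ y) ?_ ?_ ?_ ?_ ?_
    · intro y hy
      obtain ⟨h, rfl⟩ := (hmem y).1 hy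
      exact (hmem _).2 ⟨k * h, (hmul k h _).symm⟩
    · intro y hy
      obtain ⟨h, rfl⟩ := (hmem y).1 hy
      exact (hmem _).2 ⟨k⁻¹ * h, (hmul k⁻¹ h _).symm⟩
    · intro y _
      rw [hmul, inv_mul_cancel, map_one]
      rfl
    · intro y _
      rw [hmul, mul_inv_cancel, map_one]
      rfl
    · intro y _
      rfl
  have hone : gamma σ 1 (lambdaFC σ g) = lambdaFC σ g := by
    rw [map_one]
    rfl
  have htr : traceFC σ z = 0 := by
    rw [traceFC_eq_coeff]
    change coeffFC σ 1 z = 0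
    rw [hz, map_sum]
    refine Finset.sum_eq_zero fun y hy => ?_
    obtain ⟨h, rfl⟩ := (hmem y).1 hy
    exact gamma_lambdaFC_deltaOne_apply σ fun e => hg₀ (conj_eq_one_iff.1 e.symm)
  -- Distinct orbit elements send `δ_e` to multiples of distinct basis vectors, so only `λ_σ(g₀)`
  -- contributes at `g₀`.
  have hcoeff : coeffFC σ g₀ z = 1 := by
    rw [hz, map_sum, Finset.sum_eq_single (lambdaFC σ g)]
    · change (lambda σ g₀ : L2 G →L[ℂ] L2 G) (deltaOne G) g₀ = 1
      rw [lambda_deltaOne, if_pos rfl]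
    · intro y hy hne
      obtain ⟨h, rfl⟩ := (hmem y).1 hy
      refine gamma_lambdaFC_deltaOne_apply σ fun e => hne ?_
      refine (gamma_lambdaFC_eq_of_conj_eq σ hreg ?_).trans hone
      rw [← e, one_mul, inv_one, mul_one]
    · intro hn
      exact absurd ((hmem _).2 ⟨1, hone⟩) hn
  have hzero := apply_deltaOne_eq_zero_of_unique σ huniq hfix htr
  have : coeffFC σ g₀ z = 0 := by
    change (z : L2 G →L[ℂ] L2 G) (deltaOne G) g₀ = 0
    rw [hzero]
    rfl
  exact one_ne_zero (hcoeff.symm.trans this)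

end TwistedGroup

end

theorem mainTheorem10 {G : Type*} [Group G] (σ : TwistedGroup.TwoCocycle G) :
    TwistedGroup.KleppnerCondition σ ↔
      ((TwistedGroup.IsTracialState (TwistedGroup.traceFC σ) ∧
          TwistedGroup.IsGammaInvariant σ (TwistedGroup.traceFC σ)) ∧
        ∀ φ : TwistedGroup.AFC σ →ₗ[ℂ] ℂ,
          TwistedGroup.IsTracialState φ → TwistedGroup.IsGammaInvariant σ φ →
            φ = TwistedGroup.traceFC σ) := by
  exact ⟨fun hK => ⟨⟨TwistedGroup.isTracialState_traceFC σ,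
      TwistedGroup.isGammaInvariant_traceFC σ⟩,
      fun _ hφ hinv => TwistedGroup.eq_traceFC_of_kleppner σ hK hφ hinv⟩,
    fun h => TwistedGroup.kleppner_of_unique σ h.2⟩
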